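/- Let $0\le k\le N$ be integers, let $\mathcal R_{N,k}$ be the set of complex $N\times N$ matrices of rank at most $k$, and let $\mathcal R^d_{N,k}\subset\mathcal R_{N,k}$ be the subset of those matrices $A$ whose singular values, in decreasing order and counted with multiplicity, satisfy $\sigma_1(A)>\sigma_2(A)>\dots>\sigma_k(A)>0$ (so that $A$ has rank exactly $k$ and its nonzero singular values are distinct). Regard the space of complex $N\times N$ matrices as a real vector space of dimension $2N^2$ with the Frobenius norm. (i) $\mathcal R^d_{N,k}$ is a smooth (embedded) submanifold of this space, of real dimension $2(2Nk-k^2)$. (ii) $\mathcal R_{N,k}=\overline{\mathcal R^d_{N,k}}$. (iii) $\mathcal R_{N,k}\setminus\mathcal R^d_{N,k}$ is thin relatively to $\mathcal R_{N,k}$, that is, it is contained in the union of finitely many smooth embedded submanifolds of the space of matrices, each of real dimension strictly less than $2(2Nk-k^2)$. -/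

import Mathlib

open scoped ContDiff

-- The space of complex matrices carries the Frobenius norm.
attribute [local instance] Matrix.frobeniusNormedAddCommGroup Matrix.frobeniusNormedSpace

/-- `M` is a `d`-dimensional smooth (embedded) submanifold of the real normed space `E`: around each
of its points there is a smooth diffeomorphism `φ` between open subsets of `E` which carries `M` to
the part of a `d`-dimensional linear subspace `W` lying in the target of `φ`
(`φ.IsImage M W` says that `φ x ∈ W ↔ x ∈ M` for all `x` in the source of `φ`). -/
def IsSmoothSubmanifold {E : Type*} [NormedAddCommGroup E] [NormedSpace ℝ E]
    (M : Set E) (d : ℕ) : Prop :=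
  ∀ p ∈ M, ∃ (φ : OpenPartialHomeomorph E E) (W : Submodule ℝ E),
    p ∈ φ.source ∧
    ContDiffOn ℝ ∞ φ φ.source ∧
    ContDiffOn ℝ ∞ φ.symm φ.target ∧
    FiniteDimensional ℝ W ∧
    Module.finrank ℝ W = d ∧
    φ.IsImage M (W : Set E)

/-- `S` is thin relatively to a (generically) `D`-dimensional set: it is contained in the union of
finitely many submanifolds of dimension lower than `D`. -/
def IsThinRel {E : Type*} [NormedAddCommGroup E] [NormedSpace ℝ E]
    (S : Set E) (D : ℕ) : Prop :=
  ∃ (n : ℕ) (M : Fin n → Set E) (d : Fin n → ℕ),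
    (∀ i, d i < D ∧ IsSmoothSubmanifold (M i) (d i)) ∧ S ⊆ ⋃ i, M i

/-- The set of complex `N × N` matrices of rank at most `k`. -/
def rankAtMost (N k : ℕ) : Set (Matrix (Fin N) (Fin N) ℂ) :=
  {A | A.rank ≤ k}

/-- The `i`-th singular value of `A` in decreasing order, with multiplicity, counted from `i = 0`. -/
noncomputable def singVal {N : ℕ} (A : Matrix (Fin N) (Fin N) ℂ) (i : ℕ) : ℝ :=
  (Matrix.toEuclideanLin A).singularValues i

/-- The set of complex `N × N` matrices of rank at most `k` whose first `k` singular values satisfy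
`σ₁ > σ₂ > ⋯ > σₖ > 0`; such a matrix has rank exactly `k`. -/
def rankDistinct (N k : ℕ) : Set (Matrix (Fin N) (Fin N) ℂ) :=
  {A | A ∈ rankAtMost N k ∧
    (∀ i j : ℕ, i < j → j < k → singVal A j < singVal A i) ∧
    (∀ i : ℕ, i < k → 0 < singVal A i)}

/-!
Near a matrix with an invertible `k × k` corner `X`, the matrices of rank `k` form the graph of the
Schur complement map `(X, B, C) ↦ C X⁻¹ B`, so they are a submanifold. Among the matrices `A` of
rank at most `k`, those with distinct nonzero singular values are singled out by the nonvanishing of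
the Hankel determinant of the power sums `tr (Aᴴ A) ^ r`, which is a real polynomial in the entries.
The zero set of a nonzero real polynomial is thin and has a dense complement, by induction on the
degree: where some partial derivative does not vanish, the zero set is a hypersurface, and the
remaining zeros are zeros of the partial derivatives. Pulled back to the factorizations `A = B C`
this polynomial yields the density statement, and pulled back to the charts, after clearing the
denominator `det X`, it yields the thinness of the exceptional set within rank `k`. The matrices of
lower rank are covered by finitely many submanifolds of lower dimension.
-/

section Submanifold

open Set Module

variable {E F : Type*} [NormedAddCommGroup E] [NormedSpace ℝ E] [NormedAddCommGroup F]
  [NormedSpace ℝ F]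

theorem isSmoothSubmanifold_univ [FiniteDimensional ℝ E] :
    IsSmoothSubmanifold (univ : Set E) (finrank ℝ E) :=
  fun _ _ => ⟨OpenPartialHomeomorph.refl E, ⊤, mem_univ _, contDiffOn_id, contDiffOn_id,
    inferInstance, finrank_top ℝ E, fun _ _ => Iff.rfl⟩

theorem isSmoothSubmanifold_of_forall_exists_isOpen {M : Set E} {d : ℕ}
    (h : ∀ p ∈ M, ∃ U, IsOpen U ∧ p ∈ U ∧ IsSmoothSubmanifold (U ∩ M) d) :
    IsSmoothSubmanifold M d := by
  intro p hp
  obtain ⟨U, hU, hpU, hM⟩ := h p hp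
  obtain ⟨φ, W, hpφ, hφ, hφ', hW, hWd, himg⟩ := hM p ⟨hpU, hp⟩
  refine ⟨φ.restrOpen U hU, W, ⟨hpφ, hpU⟩, hφ.mono inter_subset_left,
    hφ'.mono inter_subset_left, hW, hWd, fun x hx => ?_⟩
  exact (himg hx.1).trans (and_iff_right hx.2)

theorem IsSmoothSubmanifold.preimage {M : Set F} {d : ℕ} (hM : IsSmoothSubmanifold M d)
    (L : E ≃L[ℝ] F) (φ : OpenPartialHomeomorph E F) (hφ : ContDiffOn ℝ ∞ φ φ.source)
    (hφ' : ContDiffOn ℝ ∞ φ.symm φ.target) : IsSmoothSubmanifold (φ.source ∩ φ ⁻¹' M) d := by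
  rintro p ⟨hp, hpM⟩
  obtain ⟨ψ, W, hpψ, hψ, hψ', hW, hWd, himg⟩ := hM _ hpM
  let χ := (φ.trans ψ).transHomeomorph L.symm.toHomeomorph
  have hχ : ContDiffOn ℝ ∞ χ χ.source :=
    L.symm.contDiff.comp_contDiffOn
      (hψ.comp (hφ.mono inter_subset_left) inter_subset_right)
  have hχ' : ContDiffOn ℝ ∞ χ.symm χ.target :=
    (hφ'.comp (hψ'.mono inter_subset_left) inter_subset_right).comp L.contDiff.contDiffOn
      fun _ hx => hx
  refine ⟨χ, W.map (L.symm.toLinearEquiv : F →ₗ[ℝ] E), ⟨hp, hpψ⟩, hχ, hχ', inferInstance,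
    (LinearEquiv.finrank_map_eq L.symm.toLinearEquiv W).trans hWd, fun x hx => ?_⟩
  calc L.symm (ψ (φ x)) ∈ W.map (L.symm.toLinearEquiv : F →ₗ[ℝ] E)
      ↔ ψ (φ x) ∈ W := L.symm.injective.mem_set_image
    _ ↔ φ x ∈ M := himg hx.2
    _ ↔ x ∈ φ.source ∩ φ ⁻¹' M := (and_iff_right hx.1).symm

theorem IsSmoothSubmanifold.preimage_equiv {M : Set F} {d : ℕ} (hM : IsSmoothSubmanifold M d)
    (L : E ≃L[ℝ] F) : IsSmoothSubmanifold (L ⁻¹' M) d := by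
  simpa using hM.preimage L L.toHomeomorph.toOpenPartialHomeomorph L.contDiff.contDiffOn
    L.symm.contDiff.contDiffOn

theorem IsSmoothSubmanifold.isOpen_inter {M U : Set E} {d : ℕ} (hM : IsSmoothSubmanifold M d)
    (hU : IsOpen U) : IsSmoothSubmanifold (U ∩ M) d :=
  hM.preimage (.refl ℝ E) (OpenPartialHomeomorph.ofSet U hU) contDiffOn_id contDiffOn_id

theorem IsSmoothSubmanifold.prod_zero {M : Set E} {d : ℕ} (hM : IsSmoothSubmanifold M d) :
    IsSmoothSubmanifold (M ×ˢ ({0} : Set F)) d := by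
  rintro ⟨p, z⟩ ⟨hp, -⟩
  obtain ⟨ψ, W, hpψ, hψ, hψ', hW, hWd, himg⟩ := hM _ hp
  refine ⟨ψ.prod (OpenPartialHomeomorph.refl F), W.map (LinearMap.inl ℝ E F), ⟨hpψ, mem_univ _⟩,
    (hψ.comp contDiff_fst.contDiffOn fun x hx => hx.1).prodMk contDiff_snd.contDiffOn,
    (hψ'.comp contDiff_fst.contDiffOn fun x hx => hx.1).prodMk contDiff_snd.contDiffOn,
    inferInstance,
    ((W.equivMapOfInjective _ LinearMap.inl_injective).finrank_eq.symm).trans hWd, ?_⟩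
  rintro ⟨x, y⟩ hx
  rw [SetLike.mem_coe, Submodule.map_inl]
  exact and_congr_left fun _ => himg hx.1

/-- The diffeomorphism `(x, y) ↦ (x, y - f x)` of `U × F`, which flattens the graph of `f`. -/
def graphShear {f : E → F} {U : Set E} (hU : IsOpen U) (hf : ContinuousOn f U) :
    OpenPartialHomeomorph (E × F) (E × F) where
  toFun p := (p.1, p.2 - f p.1)
  invFun p := (p.1, p.2 + f p.1)
  source := U ×ˢ univ
  target := U ×ˢ univ
  map_source' _ hp := hp
  map_target' _ hp := hp
  left_inv' p _ := by simp
  right_inv' p _ := by simp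
  open_source := hU.prod isOpen_univ
  open_target := hU.prod isOpen_univ
  continuousOn_toFun := continuousOn_fst.prodMk
    (continuousOn_snd.sub (hf.comp continuousOn_fst fun _ hp => hp.1))
  continuousOn_invFun := continuousOn_fst.prodMk
    (continuousOn_snd.add (hf.comp continuousOn_fst fun _ hp => hp.1))

theorem IsSmoothSubmanifold.graphOn {M U : Set E} {d : ℕ} (hM : IsSmoothSubmanifold M d)
    (hU : IsOpen U) {f : E → F} (hf : ContDiffOn ℝ ∞ f U) :
    IsSmoothSubmanifold ((U ∩ M).graphOn f) d := by
  have hfst : ContDiffOn ℝ ∞ (fun p : E × F => f p.1) (U ×ˢ univ) :=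
    hf.comp contDiff_fst.contDiffOn fun _ hp => hp.1
  convert (hM.prod_zero (F := F)).preimage (.refl ℝ (E × F)) (graphShear hU hf.continuousOn)
    (contDiff_fst.contDiffOn.prodMk (contDiff_snd.contDiffOn.sub hfst))
    (contDiff_fst.contDiffOn.prodMk (contDiff_snd.contDiffOn.add hfst)) using 1
  ext ⟨x, y⟩
  simp [graphShear, sub_eq_zero, eq_comm, and_assoc]

theorem exists_openPartialHomeomorph_of_hasFDerivAt_equiv [CompleteSpace E] {ψ : E → E}
    (hψ : ContDiff ℝ ∞ ψ) {p : E} {A : E ≃L[ℝ] E} (hA : HasFDerivAt ψ (A : E →L[ℝ] E) p) :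
    ∃ φ : OpenPartialHomeomorph E E, (φ : E → E) = ψ ∧ p ∈ φ.source ∧
      ContDiffOn ℝ ∞ φ.symm φ.target := by
  have h0 : (∞ : WithTop ℕ∞) ≠ 0 := by simp
  have hopen : IsOpen {x | fderiv ℝ ψ x ∈ range ((↑) : (E ≃L[ℝ] E) → E →L[ℝ] E)} :=
    ContinuousLinearEquiv.isOpen.preimage (hψ.continuous_fderiv h0)
  refine ⟨((hψ.contDiffAt (x := p)).toOpenPartialHomeomorph ψ hA h0).restrOpen _ hopen, rfl,
    ⟨ContDiffAt.mem_toOpenPartialHomeomorph_source _ hA h0, A, hA.fderiv.symm⟩, fun y hy => ?_⟩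
  obtain ⟨B, hB⟩ := (OpenPartialHomeomorph.map_target _ hy).2
  have hd := (hψ.differentiable h0 _).hasFDerivAt.congr_fderiv hB.symm
  exact (OpenPartialHomeomorph.contDiffAt_symm _ hy hd hψ.contDiffAt).contDiffWithinAt

theorem finrank_ker_of_ne_zero [FiniteDimensional ℝ E] {l : E →ₗ[ℝ] ℝ} (hl : l ≠ 0) :
    finrank ℝ (LinearMap.ker l) = finrank ℝ E - 1 := by
  have := l.finrank_range_add_finrank_ker
  rw [LinearMap.range_eq_top.2 (LinearMap.surjective hl), finrank_top, finrank_self] at this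
  omega

theorem isSmoothSubmanifold_setOf_eq_zero_and_fderiv_ne_zero [FiniteDimensional ℝ E] {g : E → ℝ}
    (hg : ContDiff ℝ ∞ g) (v : E) :
    IsSmoothSubmanifold {x | g x = 0 ∧ fderiv ℝ g x v ≠ 0} (finrank ℝ E - 1) := by
  rintro p ⟨-, hpv⟩
  have h0 : (∞ : WithTop ℕ∞) ≠ 0 := by simp
  have : CompleteSpace E := FiniteDimensional.complete ℝ E
  set l : E →L[ℝ] ℝ := fderiv ℝ g p
  -- Near `p`, adding `g x - l x` in a direction `w` with `l w = 1` turns the level set of `g` into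
  -- the kernel of `l`, and this change of coordinates has derivative `1` at `p`.
  set w : E := (l v)⁻¹ • v
  have hlw : l w = 1 := by simp [w, inv_mul_cancel₀ hpv]
  let ψ : E → E := fun x => x + (g x - l x) • w
  have hψ : ContDiff ℝ ∞ ψ := contDiff_id.add ((hg.sub l.contDiff).smul contDiff_const)
  have hψp : HasFDerivAt ψ ((ContinuousLinearEquiv.refl ℝ E : E ≃L[ℝ] E) : E →L[ℝ] E) p := by
    have hgp : HasFDerivAt g l p := (hg.differentiable h0 p).hasFDerivAt
    refine ((hasFDerivAt_id p).add ((hgp.sub l.hasFDerivAt).smul_const w)).congr_fderiv ?_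
    ext x
    simp
  have hlψ : ∀ x, l (ψ x) = g x := fun x => by simp [ψ, hlw]
  obtain ⟨φ, hφψ, hpφ, hφ'⟩ := exists_openPartialHomeomorph_of_hasFDerivAt_equiv hψ hψp
  have hopen : IsOpen {x | fderiv ℝ g x v ≠ 0} :=
    isOpen_ne_fun ((hg.continuous_fderiv h0).clm_apply continuous_const) continuous_const
  refine ⟨φ.restrOpen _ hopen, LinearMap.ker (l : E →ₗ[ℝ] ℝ), ⟨hpφ, hpv⟩, ?_,
    hφ'.mono inter_subset_left, inferInstance,
    finrank_ker_of_ne_zero fun h => hpv (LinearMap.congr_fun h v), fun x hx => ?_⟩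
  · exact hφψ ▸ hψ.contDiffOn
  · change l (φ x) = 0 ↔ g x = 0 ∧ fderiv ℝ g x v ≠ 0
    rw [hφψ, hlψ]
    exact (and_iff_left hx.2).symm

end Submanifold

section Thin

open Set

variable {E F : Type*} [NormedAddCommGroup E] [NormedSpace ℝ E] [NormedAddCommGroup F]
  [NormedSpace ℝ F]

theorem IsThinRel.mono {S T : Set E} {D : ℕ} (hT : IsThinRel T D) (hST : S ⊆ T) :
    IsThinRel S D := by
  obtain ⟨n, M, d, hM, hTM⟩ := hT
  exact ⟨n, M, d, hM, hST.trans hTM⟩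

theorem IsSmoothSubmanifold.isThinRel {M : Set E} {d D : ℕ} (hM : IsSmoothSubmanifold M d)
    (hd : d < D) : IsThinRel M D :=
  ⟨1, fun _ => M, fun _ => d, fun _ => ⟨hd, hM⟩, subset_iUnion (fun _ : Fin 1 => M) 0⟩

theorem isThinRel_empty (D : ℕ) : IsThinRel (∅ : Set E) D :=
  ⟨0, Fin.elim0, Fin.elim0, fun i => i.elim0, empty_subset _⟩

theorem IsThinRel.union {S T : Set E} {D : ℕ} (hS : IsThinRel S D) (hT : IsThinRel T D) :
    IsThinRel (S ∪ T) D := by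
  obtain ⟨m, M, d, hM, hSM⟩ := hS
  obtain ⟨n, M', d', hM', hTM⟩ := hT
  refine ⟨m + n, Fin.append M M', Fin.append d d',
    Fin.addCases (by simpa using hM) (by simpa using hM'), union_subset ?_ ?_⟩
  · exact hSM.trans (iUnion_subset fun i => subset_iUnion_of_subset (i.castAdd n) (by simp))
  · exact hTM.trans (iUnion_subset fun i => subset_iUnion_of_subset (i.natAdd m) (by simp))

theorem IsThinRel.iUnion {ι : Type*} [Finite ι] {S : ι → Set E} {D : ℕ}
    (h : ∀ i, IsThinRel (S i) D) : IsThinRel (⋃ i, S i) D := by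
  rw [← sUnion_range]
  refine (finite_range S).induction_on_subset _ (by simpa using isThinRel_empty D) ?_
  rintro _ t ⟨i, rfl⟩ - - ht
  rw [sUnion_insert]
  exact (h i).union ht

theorem IsThinRel.preimage_equiv {S : Set F} {D : ℕ} (hS : IsThinRel S D) (L : E ≃L[ℝ] F) :
    IsThinRel (L ⁻¹' S) D := by
  obtain ⟨n, M, d, hM, hSM⟩ := hS
  refine ⟨n, fun i => L ⁻¹' M i, d, fun i => (hM i).imp_right (·.preimage_equiv L), ?_⟩
  exact (preimage_mono hSM).trans preimage_iUnion.subset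

theorem IsThinRel.graphOn {S U : Set E} {D : ℕ} (hS : IsThinRel S D) (hU : IsOpen U)
    {f : E → F} (hf : ContDiffOn ℝ ∞ f U) : IsThinRel ((U ∩ S).graphOn f) D := by
  obtain ⟨n, M, d, hM, hSM⟩ := hS
  refine ⟨n, fun i => (U ∩ M i).graphOn f, d, fun i => (hM i).imp_right (·.graphOn hU hf), ?_⟩
  simp only [Set.graphOn]
  rw [← image_iUnion, ← inter_iUnion]
  exact image_mono (inter_subset_inter_right U hSM)

end Thin

section Polynomial

open Set Module Topology

variable {V W X Y : Type*} [NormedAddCommGroup V] [NormedSpace ℝ V] [NormedAddCommGroup W]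
  [NormedSpace ℝ W] [NormedAddCommGroup X] [NormedSpace ℝ X] [NormedAddCommGroup Y]
  [NormedSpace ℝ Y]

/-- Polynomial maps between real normed spaces, encoded without coordinates so that they can be
recognized on products of matrix spaces: they are generated from the constants by admitting every
differentiable map whose directional derivatives `x ↦ fderiv ℝ f x v` are all polynomial. The
induction principle is induction on the degree. -/
inductive IsPolynomialMap : (V → W) → Prop
  | const (c : W) : IsPolynomialMap fun _ => c
  | of_fderiv {f : V → W} (hf : Differentiable ℝ f)
      (h : ∀ v, IsPolynomialMap fun x => fderiv ℝ f x v) : IsPolynomialMap f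

namespace IsPolynomialMap

theorem differentiable {f : V → W} (hf : IsPolynomialMap f) : Differentiable ℝ f := by
  cases hf with
  | const c => exact differentiable_const c
  | of_fderiv hf _ => exact hf

theorem contDiff [FiniteDimensional ℝ V] {f : V → W} (hf : IsPolynomialMap f) :
    ContDiff ℝ ∞ f := by
  induction hf with
  | const c => exact contDiff_const
  | of_fderiv hf _ ih =>
    exact contDiff_infty_iff_fderiv.2 ⟨hf, contDiff_clm_apply_iff.2 ih⟩

theorem of_clm (l : V →L[ℝ] W) : IsPolynomialMap l :=
  of_fderiv l.differentiable fun v => by simpa only [l.fderiv] using const (l v)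

theorem clm_comp {f : V → W} (hf : IsPolynomialMap f) (l : W →L[ℝ] X) :
    IsPolynomialMap fun x => l (f x) := by
  induction hf with
  | const c => exact const (l c)
  | of_fderiv hf _ ih =>
    refine of_fderiv (l.differentiable.comp hf) fun v => ?_
    convert ih v using 2 with x
    exact DFunLike.congr_fun (l.hasFDerivAt.comp x (hf x).hasFDerivAt).fderiv v

theorem linearMap_comp [FiniteDimensional ℝ W] {f : V → W} (hf : IsPolynomialMap f)
    (l : W →ₗ[ℝ] X) : IsPolynomialMap fun x => l (f x) :=
  hf.clm_comp (LinearMap.toContinuousLinearMap l)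

theorem add {f g : V → W} (hf : IsPolynomialMap f) (hg : IsPolynomialMap g) :
    IsPolynomialMap fun x => f x + g x := by
  induction hf generalizing g with
  | const c =>
    cases hg with
    | const c' => exact const (c + c')
    | of_fderiv hg hg' =>
      exact of_fderiv (hg.const_add c) fun v => by simpa only [fderiv_const_add] using hg' v
  | of_fderiv hf hf' ih =>
    refine of_fderiv (hf.add hg.differentiable) fun v => ?_
    simp only [fderiv_fun_add (hf _) (hg.differentiable _), add_apply]
    cases hg with
    | const c' => simpa using hf' v
    | of_fderiv hg hg' => exact ih v (hg' v)

theorem prodMk {f : V → W} {g : V → X} (hf : IsPolynomialMap f) (hg : IsPolynomialMap g) :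
    IsPolynomialMap fun x => (f x, g x) := by
  simpa using (hf.clm_comp (.inl ℝ W X)).add (hg.clm_comp (.inr ℝ W X))

theorem sum {ι : Type*} {s : Finset ι} {f : ι → V → W} (hf : ∀ i ∈ s, IsPolynomialMap (f i)) :
    IsPolynomialMap fun x => ∑ i ∈ s, f i x := by
  classical
  induction s using Finset.induction_on with
  | empty => simpa using const (0 : W)
  | insert i s hi ih =>
    simp only [Finset.sum_insert hi]
    exact (hf i (s.mem_insert_self i)).add (ih fun j hj => hf j (Finset.mem_insert_of_mem hj))

theorem bilinear {f : V → W} {g : V → X} (hf : IsPolynomialMap f) (hg : IsPolynomialMap g)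
    (B : W →L[ℝ] X →L[ℝ] Y) : IsPolynomialMap fun x => B (f x) (g x) := by
  induction hf generalizing g with
  | const c => exact hg.clm_comp (B c)
  | of_fderiv hf hf' ihf =>
    induction hg with
    | const c => exact (of_fderiv hf hf').clm_comp (B.flip c)
    | of_fderiv hg hg' ihg =>
      refine of_fderiv ((B.differentiable.comp hf).clm_apply hg) fun v => ?_
      convert (ihg v).add (ihf v (of_fderiv hg hg')) using 2 with x
      simp [(B.hasFDerivAt_of_bilinear (hf x).hasFDerivAt (hg x).hasFDerivAt).fderiv]

theorem smul {𝕜 : Type*} [NormedField 𝕜] [NormedAlgebra ℝ 𝕜] [NormedSpace 𝕜 W]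
    [IsScalarTower ℝ 𝕜 W] {f : V → 𝕜} {g : V → W} (hf : IsPolynomialMap f)
    (hg : IsPolynomialMap g) : IsPolynomialMap fun x => f x • g x :=
  hf.bilinear hg (ContinuousLinearMap.lsmul ℝ 𝕜)

theorem prod {𝕜 ι : Type*} [NormedField 𝕜] [NormedAlgebra ℝ 𝕜] {s : Finset ι} {f : ι → V → 𝕜}
    (hf : ∀ i ∈ s, IsPolynomialMap (f i)) : IsPolynomialMap fun x => ∏ i ∈ s, f i x := by
  classical
  induction s using Finset.induction_on with
  | empty => simpa using const (1 : 𝕜)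
  | insert i s hi ih =>
    simp only [Finset.prod_insert hi]
    exact (hf i (s.mem_insert_self i)).smul (ih fun j hj => hf j (Finset.mem_insert_of_mem hj))

theorem isThinRel_setOf_eq_zero [FiniteDimensional ℝ V] {f : V → ℝ} (hf : IsPolynomialMap f)
    {x : V} (hx : f x ≠ 0) : IsThinRel {y | f y = 0} (finrank ℝ V) := by
  induction hf generalizing x with
  | const c => simpa [hx] using isThinRel_empty (finrank ℝ V)
  | @of_fderiv f hf hf' ih =>
    by_cases hconst : ∀ y v, fderiv ℝ f y v = 0
    · have hfx : ∀ y, f y = f x := fun y =>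
        is_const_of_fderiv_eq_zero hf (fun z => ContinuousLinearMap.ext (hconst z)) y x
      simpa [hfx, hx] using isThinRel_empty (finrank ℝ V)
    · push Not at hconst
      obtain ⟨z, v, hzv⟩ := hconst
      have : Nontrivial V := ⟨v, 0, fun h => hzv (by rw [h, map_zero])⟩
      have hreg := (isSmoothSubmanifold_setOf_eq_zero_and_fderiv_ne_zero
        (of_fderiv hf hf').contDiff v).isThinRel (Nat.sub_lt finrank_pos one_pos)
      refine ((ih v hzv).union hreg).mono fun y hy => ?_
      exact (eq_or_ne (fderiv ℝ f y v) 0).imp_right fun hyv => ⟨hy, hyv⟩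

theorem dense_setOf_ne_zero {f : V → W} (hf : IsPolynomialMap f) {x : V} (hx : f x ≠ 0) :
    Dense {y | f y ≠ 0} := by
  induction hf generalizing x with
  | const c => simp [hx]
  | @of_fderiv f hf _ ih =>
    intro z
    by_contra hz
    -- If `f` vanishes near `z`, so do its directional derivatives, which hence vanish everywhere.
    have hfz : f =ᶠ[𝓝 z] fun _ => 0 := by
      simpa [mem_closure_iff_frequently, Filter.EventuallyEq] using hz
    have hderiv : ∀ y v, fderiv ℝ f y v = 0 := by
      by_contra! ⟨y, v, hyv⟩
      refine mem_closure_iff_frequently.1 (ih v hyv z) ((hfz.fderiv (𝕜 := ℝ)).mono fun w hw => ?_)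
      simp [hw]
    have hxz := is_const_of_fderiv_eq_zero hf (fun y => ContinuousLinearMap.ext (hderiv y)) x z
    exact hx (hxz.trans hfz.self_of_nhds)

end IsPolynomialMap

end Polynomial

section MatrixPolynomial

open Matrix Module

namespace IsPolynomialMap

variable {𝕜 V : Type*} [NormedField 𝕜] [NormedAlgebra ℝ 𝕜] [FiniteDimensional ℝ 𝕜]
  [NormedAddCommGroup V] [NormedSpace ℝ V] {m n o : Type*} [Fintype m] [Fintype n] [Fintype o]

theorem matrix_apply {A : V → Matrix m n 𝕜} (hA : IsPolynomialMap A) (i : m) (j : n) :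
    IsPolynomialMap fun x => A x i j :=
  hA.linearMap_comp (entryLinearMap ℝ 𝕜 i j)

theorem of_matrix_apply {A : V → Matrix m n 𝕜} (hA : ∀ i j, IsPolynomialMap fun x => A x i j) :
    IsPolynomialMap A := by
  classical
  rw [show A = fun x => ∑ i, ∑ j, single i j (A x i j) from funext fun x => matrix_eq_sum_single _]
  exact sum fun i _ => sum fun j _ => (hA i j).linearMap_comp (singleLinearMap ℝ i j)

theorem matrix_mul {A : V → Matrix m n 𝕜} {B : V → Matrix n o 𝕜} (hA : IsPolynomialMap A)
    (hB : IsPolynomialMap B) : IsPolynomialMap fun x => A x * B x :=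
  hA.bilinear hB
    (mulLinearMap ℝ : Matrix m n 𝕜 →ₗ[ℝ] Matrix n o 𝕜 →ₗ[ℝ] Matrix m o 𝕜).toContinuousBilinearMap

theorem matrix_pow [DecidableEq n] {A : V → Matrix n n 𝕜} (hA : IsPolynomialMap A) (r : ℕ) :
    IsPolynomialMap fun x => A x ^ r := by
  induction r with
  | zero => simpa only [pow_zero] using const 1
  | succ r ih => simpa only [pow_succ] using ih.matrix_mul hA

theorem matrix_det [DecidableEq n] {A : V → Matrix n n 𝕜} (hA : IsPolynomialMap A) :
    IsPolynomialMap fun x => (A x).det := by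
  simp only [det_apply, Units.smul_def, ← Int.cast_smul_eq_zsmul ℝ]
  exact sum fun σ _ => (const _).smul (prod fun i _ => hA.matrix_apply _ _)

theorem matrix_adjugate [DecidableEq n] {A : V → Matrix n n 𝕜} (hA : IsPolynomialMap A) :
    IsPolynomialMap fun x => (A x).adjugate := by
  refine of_matrix_apply fun i j => ?_
  simp only [adjugate_apply]
  refine matrix_det (of_matrix_apply fun a b => ?_)
  rcases eq_or_ne a j with rfl | haj
  · simpa only [updateRow_self] using const _
  · simpa only [updateRow_ne haj] using hA.matrix_apply a b

end IsPolynomialMap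

end MatrixPolynomial

section HankelDet

open Matrix

variable {𝕜 : Type*} [RCLike 𝕜] {m n : Type*} [Fintype m] [Fintype n] [DecidableEq n]

/-- The Hankel determinant of the power sums `tr (Aᴴ A) ^ r`, `1 ≤ r ≤ 2k - 1`. If `A` has rank at
most `k` and `sᵢ` are the squares of its first `k` singular values, it equals
`∏ᵢ sᵢ * ∏_{i < j} (sⱼ - sᵢ) ^ 2`, so that it is a real polynomial in the entries of `A` which
detects whether these singular values are distinct and nonzero. -/
noncomputable def hankelDet (k : ℕ) (A : Matrix m n 𝕜) : ℝ :=
  (of fun i j : Fin k => RCLike.re ((Aᴴ * A) ^ (i + j + 1 : ℕ)).trace).det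

theorem hankelDet_ne_zero_iff {k : ℕ} {A : Matrix m n 𝕜} {s : Fin k → ℝ}
    (hs : ∀ r : ℕ, RCLike.re ((Aᴴ * A) ^ (r + 1)).trace = ∑ i, s i ^ (r + 1)) :
    hankelDet k A ≠ 0 ↔ Function.Injective s ∧ ∀ i, s i ≠ 0 := by
  have hvandermonde : (of fun i j : Fin k => RCLike.re ((Aᴴ * A) ^ (i + j + 1 : ℕ)).trace) =
      (vandermonde s)ᵀ * (diagonal s * vandermonde s) := by
    ext i j
    rw [of_apply, hs, mul_apply]
    refine Finset.sum_congr rfl fun l _ => ?_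
    rw [diagonal_mul, transpose_apply, vandermonde_apply, vandermonde_apply]
    ring
  rw [hankelDet, hvandermonde, det_mul, det_mul, det_transpose, det_diagonal, mul_ne_zero_iff,
    mul_ne_zero_iff, det_vandermonde_ne_zero_iff, Finset.prod_ne_zero_iff]
  simp only [Finset.mem_univ, forall_const]
  tauto

theorem re_trace_conjTranspose_mul_self_pow_smul (c : 𝕜) (A : Matrix m n 𝕜) (r : ℕ) :
    RCLike.re (((c • A)ᴴ * (c • A)) ^ r).trace =
      (‖c‖ ^ 2) ^ r * RCLike.re ((Aᴴ * A) ^ r).trace := by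
  have hc : (c • A)ᴴ * (c • A) = ((‖c‖ ^ 2 : ℝ) : 𝕜) • (Aᴴ * A) := by
    rw [conjTranspose_smul, Matrix.smul_mul, Matrix.mul_smul, smul_smul, RCLike.ofReal_pow,
      ← RCLike.conj_mul, starRingEnd_apply]
  rw [hc, smul_pow, trace_smul, smul_eq_mul, ← RCLike.ofReal_pow, RCLike.re_ofReal_mul]

theorem hankelDet_smul_ne_zero_iff {k : ℕ} {c : 𝕜} (hc : c ≠ 0) {A : Matrix m n 𝕜} :
    hankelDet k (c • A) ≠ 0 ↔ hankelDet k A ≠ 0 := by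
  set t : ℝ := ‖c‖ ^ 2
  have ht : t ≠ 0 := by simpa [t] using hc
  have hscale : hankelDet k (c • A) =
      (∏ i : Fin k, t ^ (i + 1 : ℕ)) * ((∏ j : Fin k, t ^ (j : ℕ)) * hankelDet k A) := by
    rw [hankelDet, hankelDet, ← det_mul_row, ← det_mul_column]
    congr 1
    ext i j
    simp only [of_apply, re_trace_conjTranspose_mul_self_pow_smul]
    ring
  simp [hscale, Finset.prod_ne_zero_iff, ht]

theorem IsPolynomialMap.hankelDet {V : Type*} [NormedAddCommGroup V] [NormedSpace ℝ V] (k : ℕ)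
    {A : V → Matrix m n 𝕜} (hA : IsPolynomialMap A) :
    IsPolynomialMap fun x => hankelDet k (A x) := by
  have hconj : IsPolynomialMap fun x => (A x)ᴴ :=
    .of_matrix_apply fun i j => (hA.matrix_apply j i).linearMap_comp RCLike.conjLIE.toLinearMap
  refine .matrix_det (.of_matrix_apply fun i j => ?_)
  exact ((hconj.matrix_mul hA).matrix_pow _).linearMap_comp
    (RCLike.reLm ∘ₗ traceLinearMap n ℝ 𝕜)

theorem conj_pow_succ_of_mul_eq_one {R : Type*} [CommRing R] {o : Type*} [Fintype o]
    [DecidableEq o] {V : Matrix n o R} {V' : Matrix o n R} (hV : V' * V = 1) (M : Matrix o o R)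
    (r : ℕ) : (V * M * V') ^ (r + 1) = V * M ^ (r + 1) * V' := by
  induction r with
  | zero => simp
  | succ r ih =>
    calc (V * M * V') ^ (r + 1 + 1)
        = V * M ^ (r + 1) * (V' * V) * M * V' := by rw [pow_succ, ih]; simp only [Matrix.mul_assoc]
      _ = V * M ^ (r + 1 + 1) * V' := by
        rw [hV, Matrix.mul_one, Matrix.mul_assoc V, ← pow_succ]

theorem hankelDet_mul_diagonal_mul_conjTranspose_ne_zero_iff {k : ℕ} {U : Matrix m (Fin k) 𝕜}
    {V : Matrix n (Fin k) 𝕜} (hU : Uᴴ * U = 1) (hV : Vᴴ * V = 1) (s : Fin k → ℝ) :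
    hankelDet k (U * diagonal (fun i => (s i : 𝕜)) * Vᴴ) ≠ 0 ↔
      Function.Injective (fun i => s i ^ 2) ∧ ∀ i, s i ^ 2 ≠ 0 := by
  refine hankelDet_ne_zero_iff fun r => ?_
  set D : Matrix (Fin k) (Fin k) 𝕜 := diagonal fun i => (s i : 𝕜)
  have hD : Dᴴ * D = diagonal fun i => ((s i ^ 2 : ℝ) : 𝕜) := by
    simp [D, diagonal_conjTranspose, sq]
  have hgram : (U * D * Vᴴ)ᴴ * (U * D * Vᴴ) = V * (Dᴴ * D) * Vᴴ :=
    calc (U * D * Vᴴ)ᴴ * (U * D * Vᴴ) = V * Dᴴ * (Uᴴ * U) * D * Vᴴ := by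
          simp only [conjTranspose_mul, conjTranspose_conjTranspose, Matrix.mul_assoc]
      _ = V * (Dᴴ * D) * Vᴴ := by rw [hU, Matrix.mul_one, Matrix.mul_assoc V]
  rw [hgram, conj_pow_succ_of_mul_eq_one hV, Matrix.mul_assoc, trace_mul_comm, Matrix.mul_assoc, hV,
    Matrix.mul_one, hD, diagonal_pow, trace_diagonal, map_sum]
  refine Finset.sum_congr rfl fun i _ => ?_
  rw [Pi.pow_apply, ← RCLike.ofReal_pow, RCLike.ofReal_re]

omit [DecidableEq n] in
theorem exists_conjTranspose_mul_self_eq_one {k : ℕ} (hk : k ≤ Fintype.card n) :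
    ∃ V : Matrix n (Fin k) 𝕜, Vᴴ * V = 1 := by
  classical
  obtain ⟨f⟩ := Function.Embedding.nonempty_of_card_le (α := Fin k) (β := n) (by simpa using hk)
  refine ⟨(1 : Matrix n n 𝕜).submatrix id f, ?_⟩
  rw [conjTranspose_submatrix, conjTranspose_one, ← submatrix_mul _ _ _ _ _ Function.bijective_id,
    Matrix.one_mul, submatrix_one _ f.injective]

theorem exists_hankelDet_mul_ne_zero {k : ℕ} (hm : k ≤ Fintype.card m)
    (hn : k ≤ Fintype.card n) :
    ∃ (B : Matrix m (Fin k) 𝕜) (C : Matrix (Fin k) n 𝕜), hankelDet k (B * C) ≠ 0 := by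
  obtain ⟨U, hU⟩ := exists_conjTranspose_mul_self_eq_one (𝕜 := 𝕜) hm
  obtain ⟨V, hV⟩ := exists_conjTranspose_mul_self_eq_one (𝕜 := 𝕜) hn
  refine ⟨_, _, (hankelDet_mul_diagonal_mul_conjTranspose_ne_zero_iff hU hV fun i => i + 1).2
    ⟨fun i j hij => ?_, fun i => by positivity⟩⟩
  rw [sq_eq_sq₀ (by positivity) (by positivity), add_left_inj, Nat.cast_inj] at hij
  exact Fin.ext hij

end HankelDet

section SingularValues

open Matrix Module

theorem rank_eq_finrank_range_toEuclideanLin {𝕜 : Type*} [RCLike 𝕜] {m n : Type*} [Finite m]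
    [Fintype n] [DecidableEq n] (A : Matrix m n 𝕜) :
    A.rank = finrank 𝕜 (LinearMap.range (toEuclideanLin A)) := by
  classical
  have := Fintype.ofFinite m
  rw [toEuclideanLin, toLpLin_eq_toLin, ← rank_eq_finrank_range_toLin]

theorem trace_pow_eq_sum_eigenvalues_pow {𝕜 E : Type*} [RCLike 𝕜] [NormedAddCommGroup E]
    [InnerProductSpace 𝕜 E] [FiniteDimensional 𝕜 E] {n : ℕ} (hn : finrank 𝕜 E = n)
    {T : E →ₗ[𝕜] E} (hT : T.IsSymmetric) (r : ℕ) :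
    LinearMap.trace 𝕜 E (T ^ r) = ∑ i, (hT.eigenvalues hn i : 𝕜) ^ r := by
  have hpow : ∀ i, (T ^ r) (hT.eigenvectorBasis hn i) =
      (hT.eigenvalues hn i : 𝕜) ^ r • hT.eigenvectorBasis hn i := fun i =>
    (hT.hasEigenvector_eigenvectorBasis hn i).pow_apply r
  rw [LinearMap.trace_eq_sum_inner _ (hT.eigenvectorBasis hn)]
  refine Finset.sum_congr rfl fun i _ => ?_
  rw [hpow, inner_smul_right, inner_self_eq_norm_sq_to_K, (hT.eigenvectorBasis hn).norm_eq_one]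
  simp

variable {N k : ℕ} {A : Matrix (Fin N) (Fin N) ℂ}

theorem singVal_pos_iff {i : ℕ} : 0 < singVal A i ↔ i < A.rank := by
  rw [singVal, LinearMap.singularValues_pos_iff_lt_finrank_range,
    rank_eq_finrank_range_toEuclideanLin]

theorem singVal_nonneg (A : Matrix (Fin N) (Fin N) ℂ) (i : ℕ) : 0 ≤ singVal A i :=
  (toEuclideanLin A).singularValues_nonneg i

theorem re_trace_conjTranspose_mul_self_pow (A : Matrix (Fin N) (Fin N) ℂ) (r : ℕ) :
    RCLike.re ((Aᴴ * A) ^ r).trace = ∑ i : Fin N, (singVal A i ^ 2) ^ r := by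
  set T := toEuclideanLin A
  have hn : finrank ℂ (EuclideanSpace ℂ (Fin N)) = N := finrank_euclideanSpace_fin
  have htrace : ((Aᴴ * A) ^ r).trace = LinearMap.trace ℂ _ ((T.adjoint ∘ₗ T) ^ r) := by
    rw [← toEuclideanLin_conjTranspose_eq_adjoint, ← toLpLin_mul_same, ← toLpLin_pow,
      toLpLin_eq_toLin, LinearMap.trace_eq_matrix_trace ℂ (PiLp.basisFun 2 ℂ (Fin N)),
      LinearMap.toMatrix_toLin]
  rw [htrace, trace_pow_eq_sum_eigenvalues_pow hn T.isSymmetric_adjoint_comp_self, map_sum]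
  refine Finset.sum_congr rfl fun i _ => ?_
  rw [← T.sq_singularValues_fin hn, ← RCLike.ofReal_pow, RCLike.ofReal_re, singVal]

theorem re_trace_conjTranspose_mul_self_pow_of_rank_le (hk : k ≤ N) (hA : A.rank ≤ k) (r : ℕ) :
    RCLike.re ((Aᴴ * A) ^ (r + 1)).trace = ∑ i : Fin k, (singVal A i ^ 2) ^ (r + 1) := by
  rw [re_trace_conjTranspose_mul_self_pow,
    Fin.sum_univ_eq_sum_range (fun i => (singVal A i ^ 2) ^ (r + 1)),
    Fin.sum_univ_eq_sum_range (fun i => (singVal A i ^ 2) ^ (r + 1))]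
  refine (Finset.sum_subset (Finset.range_subset_range.2 hk) fun i _ hi => ?_).symm
  have hki : k ≤ i := by simpa using hi
  have hzero : singVal A i = 0 :=
    (singVal_nonneg A i).antisymm' (not_lt.1 fun h => (singVal_pos_iff.1 h).not_ge (hA.trans hki))
  simp [hzero]

theorem mem_rankDistinct_iff_strictAnti : A ∈ rankDistinct N k ↔ A.rank ≤ k ∧
    StrictAnti (fun i : Fin k => singVal A i) ∧ ∀ i : Fin k, 0 < singVal A i :=
  and_congr_right fun _ => and_congr
    ⟨fun h i j hij => h i j hij j.2, fun h i j hij hj => @h ⟨i, hij.trans hj⟩ ⟨j, hj⟩ hij⟩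
    ⟨fun h i => h i i.2, fun h i hi => h ⟨i, hi⟩⟩

theorem mem_rankDistinct_iff (hk : k ≤ N) :
    A ∈ rankDistinct N k ↔ A.rank ≤ k ∧ hankelDet k A ≠ 0 := by
  refine mem_rankDistinct_iff_strictAnti.trans (and_congr_right fun hA => ?_)
  have hanti : Antitone fun i : Fin k => singVal A i := fun i j hij =>
    (toEuclideanLin A).singularValues_antitone hij
  have hsq : (fun i : Fin k => singVal A i ^ 2).Injective ↔
      (fun i : Fin k => singVal A i).Injective :=
    forall₂_congr fun i j => by simp only [sq_eq_sq₀ (singVal_nonneg A _) (singVal_nonneg A _)]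
  rw [hankelDet_ne_zero_iff (re_trace_conjTranspose_mul_self_pow_of_rank_le hk hA), hsq,
    ← hanti.strictAnti_iff_injective]
  simp only [(singVal_nonneg A _).lt_iff_ne', ne_eq, sq_eq_zero_iff]

theorem rank_of_mem_rankDistinct (hA : A ∈ rankDistinct N k) : A.rank = k :=
  le_antisymm hA.1 (le_of_forall_lt fun i hi => singVal_pos_iff.1 (hA.2.2 i hi))

end SingularValues

section RankFactorization

open Matrix Module

variable {K : Type*} [Field K] {m n : Type*} [Fintype n]

theorem rank_le_iff_exists_eq_mul {k : ℕ} {A : Matrix m n K} :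
    A.rank ≤ k ↔ ∃ (B : Matrix m (Fin k) K) (C : Matrix (Fin k) n K), A = B * C := by
  classical
  refine ⟨fun hA => ?_, ?_⟩
  · obtain ⟨i, hi⟩ : ∃ i : LinearMap.range A.mulVecLin →ₗ[K] Fin k → K, Function.Injective i :=
      finrank_le_iff_exists_linearMap.1 (hA.trans_eq (finrank_fin_fun K).symm)
    obtain ⟨s, hs⟩ := i.exists_leftInverse_of_injective (LinearMap.ker_eq_bot.2 hi)
    refine ⟨LinearMap.toMatrix' ((LinearMap.range A.mulVecLin).subtype ∘ₗ s),
      LinearMap.toMatrix' (i ∘ₗ A.mulVecLin.rangeRestrict), ?_⟩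
    rw [← LinearMap.toMatrix'_comp, LinearMap.comp_assoc, ← LinearMap.comp_assoc _ i s, hs,
      LinearMap.id_comp, LinearMap.subtype_comp_codRestrict]
    exact (LinearMap.toMatrix'_toLin' A).symm
  · rintro ⟨B, C, rfl⟩
    exact (rank_mul_le_left B C).trans ((rank_le_card_width B).trans_eq (Fintype.card_fin k))

theorem rank_fromBlocks_le_iff {κ : Type*} [Fintype κ] [DecidableEq κ] {X : Matrix κ κ K}
    (hX : X.det ≠ 0) (B : Matrix κ n K) (C : Matrix m κ K) (D : Matrix m n K) :
    (fromBlocks X B C D).rank ≤ Fintype.card κ ↔ D = C * X⁻¹ * B := by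
  have hXu : IsUnit X.det := hX.isUnit
  refine ⟨fun h => ?_, ?_⟩
  · obtain ⟨P, Q, hPQ⟩ := rank_le_iff_exists_eq_mul.1 h
    rw [← fromRows_toRows P, ← fromCols_toCols Q, fromRows_mul_fromCols, fromBlocks_inj] at hPQ
    obtain ⟨hX', rfl, rfl, rfl⟩ := hPQ
    have hinv : Q.toCols₁ * X⁻¹ * P.toRows₁ = 1 := by
      have hinv' : P.toRows₁ * (Q.toCols₁ * X⁻¹) = 1 := by
        rw [← Matrix.mul_assoc, ← hX', mul_nonsing_inv _ hXu]
      exact (mul_eq_one_comm_of_card_eq _ _ _ (Fintype.card_fin _).symm).1 hinv'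
    calc P.toRows₂ * Q.toCols₂
        = P.toRows₂ * (Q.toCols₁ * X⁻¹ * P.toRows₁) * Q.toCols₂ := by rw [hinv, Matrix.mul_one]
      _ = P.toRows₂ * Q.toCols₁ * X⁻¹ * (P.toRows₁ * Q.toCols₂) := by
        simp only [Matrix.mul_assoc]
  · rintro rfl
    have hfactor : fromBlocks X B C (C * X⁻¹ * B) = fromRows 1 (C * X⁻¹) * fromCols X B := by
      rw [fromRows_mul_fromCols, Matrix.one_mul, Matrix.one_mul,
        nonsing_inv_mul_cancel_right _ _ hXu]
    rw [hfactor]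
    exact (rank_mul_le_left _ _).trans (rank_le_card_width _)

theorem exists_linearIndependent_rows [Finite m] {k : ℕ} {A : Matrix m n K} (hA : A.rank = k) :
    ∃ r : Fin k → m, LinearIndependent K (A.submatrix r id).row := by
  have := Fintype.ofFinite m
  rw [rank_eq_finrank_span_row] at hA
  subst hA
  obtain ⟨f, hf, -, hli⟩ := Submodule.exists_fun_fin_finrank_span_eq K (Set.range A.row)
  choose r hr using hf
  exact ⟨r, (funext hr : (A.submatrix r id).row = f) ▸ hli⟩

theorem exists_submatrix_det_ne_zero [Finite m] {k : ℕ} {A : Matrix m n K} (hA : A.rank = k) :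
    ∃ (r : Fin k → m) (c : Fin k → n), (A.submatrix r c).det ≠ 0 := by
  have := Fintype.ofFinite m
  obtain ⟨r, hr⟩ := exists_linearIndependent_rows hA
  have hrank : (A.submatrix r id)ᵀ.rank = k := by
    rw [rank_transpose, hr.rank_matrix, Fintype.card_fin]
  obtain ⟨c, hc⟩ := exists_linearIndependent_rows hrank
  refine ⟨r, c, ?_⟩
  rw [← det_transpose]
  exact ((isUnit_iff_isUnit_det _).1 (linearIndependent_rows_iff_isUnit.1 hc)).ne_zero

theorem injective_of_submatrix_det_ne_zero {R κ : Type*} [CommRing R] [Fintype κ] [DecidableEq κ]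
    {m n : Type*} {A : Matrix m n R} {r : κ → m} {c : κ → n} (h : (A.submatrix r c).det ≠ 0) :
    Function.Injective r ∧ Function.Injective c := by
  refine ⟨fun i j hij => ?_, fun i j hij => ?_⟩ <;> by_contra hne
  · exact h (det_zero_of_row_eq hne (funext fun l => by simp only [submatrix_apply, hij]))
  · exact h (det_zero_of_column_eq hne fun l => by simp only [submatrix_apply, hij])

variable [Fintype m]

theorem exists_equiv_sum_of_injective {k : ℕ} {r : Fin k → m} (hr : Function.Injective r) :
    ∃ e : Fin k ⊕ Fin (Fintype.card m - k) ≃ m, e ∘ Sum.inl = r := by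
  classical
  have hcard : Fintype.card {x // x ∉ Set.range r} = Fintype.card m - k := by
    rw [Fintype.card_subtype_compl]
    exact congrArg _ ((Set.card_range_of_injective hr).trans (Fintype.card_fin k))
  refine ⟨((Equiv.ofInjective r hr).sumCongr (Fintype.equivFinOfCardEq hcard).symm).trans
    (Equiv.sumCompl (· ∈ Set.range r)), ?_⟩
  ext i
  simp

theorem exists_equiv_submatrix_det_ne_zero {k : ℕ} {A : Matrix m n K} (hA : A.rank = k) :
    ∃ (e : Fin k ⊕ Fin (Fintype.card m - k) ≃ m) (e' : Fin k ⊕ Fin (Fintype.card n - k) ≃ n),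
      (A.submatrix (e ∘ Sum.inl) (e' ∘ Sum.inl)).det ≠ 0 := by
  obtain ⟨r, c, h⟩ := exists_submatrix_det_ne_zero hA
  obtain ⟨hr, hc⟩ := injective_of_submatrix_det_ne_zero h
  obtain ⟨e, he⟩ := exists_equiv_sum_of_injective hr
  obtain ⟨e', he'⟩ := exists_equiv_sum_of_injective hc
  exact ⟨e, e', by rwa [he, he']⟩

end RankFactorization

section SchurChart

open Matrix Module

/-- The first column of blocks and the first row of blocks of a `2 × 2` block matrix with square
upper left block. They are coordinates on the block matrices whose rank is the size of that block,
as long as it is invertible. -/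
abbrev CornerBlocks (κ μ ν R : Type*) : Type _ :=
  Matrix κ κ R × Matrix κ ν R × Matrix μ κ R

/-- The block `C X⁻¹ B`, which is the only lower right block completing `X`, `B`, `C` to a matrix of
the same rank as the invertible block `X`. -/
noncomputable def schurBlock {κ μ ν R : Type*} [Fintype κ] [DecidableEq κ] [CommRing R]
    (x : CornerBlocks κ μ ν R) : Matrix μ ν R :=
  x.2.2 * x.1⁻¹ * x.2.1

theorem schurBlock_eq_inv_det_smul {κ μ ν K : Type*} [Fintype κ] [DecidableEq κ] [Field K]
    (x : CornerBlocks κ μ ν K) :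
    schurBlock x = x.1.det⁻¹ • (x.2.2 * x.1.adjugate * x.2.1) := by
  rw [schurBlock, inv_def, Ring.inverse_eq_inv', Matrix.mul_smul, Matrix.smul_mul]

variable {𝕜 κ μ ν m n : Type*} [RCLike 𝕜] [Fintype κ] [Fintype m] [Fintype n]

/-- Decomposition of a matrix into its four blocks, the rows and columns being split along `e` and
`e'`. The lower right block is separated from the other three. -/
noncomputable def blockEquiv (e : κ ⊕ μ ≃ m) (e' : κ ⊕ ν ≃ n) :
    Matrix m n 𝕜 ≃L[ℝ] CornerBlocks κ μ ν 𝕜 × Matrix μ ν 𝕜 :=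
  LinearEquiv.toContinuousLinearEquiv
    { toFun A := (((A.submatrix e e').toBlocks₁₁, (A.submatrix e e').toBlocks₁₂,
        (A.submatrix e e').toBlocks₂₁), (A.submatrix e e').toBlocks₂₂)
      invFun x := (fromBlocks x.1.1 x.1.2.1 x.1.2.2 x.2).submatrix e.symm e'.symm
      map_add' _ _ := rfl
      map_smul' _ _ := rfl
      left_inv A := by simp [fromBlocks_toBlocks]
      right_inv x := by simp }

variable (e : κ ⊕ μ ≃ m) (e' : κ ⊕ ν ≃ n)

omit [Fintype κ] in
theorem blockEquiv_smul (c : 𝕜) (A : Matrix m n 𝕜) :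
    blockEquiv e e' (c • A) = c • blockEquiv e e' A :=
  rfl

theorem card_le_rank_of_blockEquiv [DecidableEq κ] {A : Matrix m n 𝕜}
    (hA : (blockEquiv e e' A).1.1.det ≠ 0) : Fintype.card κ ≤ A.rank := by
  rw [← rank_of_det_ne_zero hA]
  exact rank_submatrix_le A _ _

theorem rank_eq_card_iff_eq_schurBlock [DecidableEq κ] {A : Matrix m n 𝕜}
    (hA : (blockEquiv e e' A).1.1.det ≠ 0) : A.rank = Fintype.card κ ↔
      (blockEquiv e e' A).2 = schurBlock (blockEquiv e e' A).1 := by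
  have : Finite (κ ⊕ ν) := .of_equiv n e'.symm
  have : Finite ν := .of_injective (Sum.inr : ν → κ ⊕ ν) Sum.inr_injective
  have := Fintype.ofFinite ν
  rw [← (card_le_rank_of_blockEquiv e e' hA).ge_iff_eq', ← rank_submatrix A e e',
    ← fromBlocks_toBlocks (A.submatrix e e')]
  exact rank_fromBlocks_le_iff hA _ _ _

theorem blockEquiv_preimage_graphOn_schurBlock [DecidableEq κ] (S : Set (CornerBlocks κ μ ν 𝕜)) :
    blockEquiv e e' ⁻¹' (({x | x.1.det ≠ 0} ∩ S).graphOn schurBlock) =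
      {A | (blockEquiv e e' A).1.1.det ≠ 0 ∧ (blockEquiv e e' A).1 ∈ S ∧
        A.rank = Fintype.card κ} := by
  ext A
  simp only [Set.mem_preimage, Set.mem_graphOn, Set.mem_inter_iff, Set.mem_ofPred_eq, and_assoc]
  refine and_congr_right fun hA => and_congr_right fun _ => ?_
  rw [rank_eq_card_iff_eq_schurBlock e e' hA, eq_comm]

instance {κ μ ν : Type*} [Finite κ] [Finite μ] [Finite ν] :
    FiniteDimensional ℝ (CornerBlocks κ μ ν 𝕜) :=
  have : FiniteDimensional ℝ (Matrix κ ν 𝕜 × Matrix μ κ 𝕜) := Module.Finite.prod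
  Module.Finite.prod

include e e' in
theorem finrank_cornerBlocks : finrank ℝ (CornerBlocks κ μ ν 𝕜) =
    Fintype.card κ * (Fintype.card m + Fintype.card n - Fintype.card κ) * finrank ℝ 𝕜 := by
  have : Fintype μ := .ofInjective (e ∘ Sum.inr) (e.injective.comp Sum.inr_injective)
  have : Fintype ν := .ofInjective (e' ∘ Sum.inr) (e'.injective.comp Sum.inr_injective)
  have : FiniteDimensional ℝ (Matrix κ ν 𝕜 × Matrix μ κ 𝕜) := Module.Finite.prod
  have hm : Fintype.card m = Fintype.card κ + Fintype.card μ := by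
    rw [← Fintype.card_congr e, Fintype.card_sum]
  have hn : Fintype.card n = Fintype.card κ + Fintype.card ν := by
    rw [← Fintype.card_congr e', Fintype.card_sum]
  rw [finrank_prod, finrank_prod, finrank_matrix, finrank_matrix, finrank_matrix, hm, hn,
    add_assoc, Nat.add_sub_cancel_left]
  ring

variable [DecidableEq κ]

theorem isOpen_setOf_det_fst_ne_zero : IsOpen {x : CornerBlocks κ μ ν 𝕜 | x.1.det ≠ 0} :=
  isOpen_ne_fun continuous_fst.matrix_det continuous_const

variable [Fintype μ] [Fintype ν]

theorem isPolynomialMap_det_fst :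
    IsPolynomialMap fun x : CornerBlocks κ μ ν 𝕜 => x.1.det :=
  .matrix_det (.of_clm (.fst ℝ (Matrix κ κ 𝕜) (Matrix κ ν 𝕜 × Matrix μ κ 𝕜)))

theorem isPolynomialMap_mul_adjugate_mul :
    IsPolynomialMap fun x : CornerBlocks κ μ ν 𝕜 => x.2.2 * x.1.adjugate * x.2.1 := by
  have hX : IsPolynomialMap fun x : CornerBlocks κ μ ν 𝕜 => x.1 :=
    .of_clm (.fst ℝ (Matrix κ κ 𝕜) (Matrix κ ν 𝕜 × Matrix μ κ 𝕜))
  have hBC : IsPolynomialMap fun x : CornerBlocks κ μ ν 𝕜 => x.2 :=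
    .of_clm (.snd ℝ (Matrix κ κ 𝕜) (Matrix κ ν 𝕜 × Matrix μ κ 𝕜))
  have hB := hBC.clm_comp (.fst ℝ (Matrix κ ν 𝕜) (Matrix μ κ 𝕜))
  have hC := hBC.clm_comp (.snd ℝ (Matrix κ ν 𝕜) (Matrix μ κ 𝕜))
  exact (hC.matrix_mul hX.matrix_adjugate).matrix_mul hB

theorem contDiffOn_schurBlock :
    ContDiffOn ℝ ∞ (schurBlock (κ := κ) (μ := μ) (ν := ν) (R := 𝕜)) {x | x.1.det ≠ 0} := by
  rw [funext schurBlock_eq_inv_det_smul]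
  exact (isPolynomialMap_det_fst.contDiff.contDiffOn.inv fun _ hx => hx).smul
    isPolynomialMap_mul_adjugate_mul.contDiff.contDiffOn

theorem IsSmoothSubmanifold.setOf_blockEquiv_mem_and_rank_eq
    {S : Set (CornerBlocks κ μ ν 𝕜)} {d : ℕ} (hS : IsSmoothSubmanifold S d) :
    IsSmoothSubmanifold {A | (blockEquiv e e' A).1.1.det ≠ 0 ∧ (blockEquiv e e' A).1 ∈ S ∧
      A.rank = Fintype.card κ} d := by
  rw [← blockEquiv_preimage_graphOn_schurBlock]
  exact (hS.graphOn isOpen_setOf_det_fst_ne_zero contDiffOn_schurBlock).preimage_equiv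
    (blockEquiv e e')

theorem IsThinRel.setOf_blockEquiv_mem_and_rank_eq {S : Set (CornerBlocks κ μ ν 𝕜)}
    {D : ℕ} (hS : IsThinRel S D) :
    IsThinRel {A | (blockEquiv e e' A).1.1.det ≠ 0 ∧ (blockEquiv e e' A).1 ∈ S ∧
      A.rank = Fintype.card κ} D := by
  rw [← blockEquiv_preimage_graphOn_schurBlock]
  exact (hS.graphOn isOpen_setOf_det_fst_ne_zero contDiffOn_schurBlock).preimage_equiv
    (blockEquiv e e')

end SchurChart

section RankStrata

open Matrix Module

variable {𝕜 m n : Type*} [RCLike 𝕜] [Fintype m] [Fintype n]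

theorem isSmoothSubmanifold_setOf_rank_eq (k : ℕ) :
    IsSmoothSubmanifold {A : Matrix m n 𝕜 | A.rank = k}
      (k * (Fintype.card m + Fintype.card n - k) * finrank ℝ 𝕜) := by
  refine isSmoothSubmanifold_of_forall_exists_isOpen fun A hA => ?_
  obtain ⟨e, e', hdet⟩ := exists_equiv_submatrix_det_ne_zero hA
  have hchart := IsSmoothSubmanifold.setOf_blockEquiv_mem_and_rank_eq (𝕜 := 𝕜) e e'
    isSmoothSubmanifold_univ
  simp only [finrank_cornerBlocks e e', Set.mem_univ, true_and, Fintype.card_fin] at hchart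
  exact ⟨_, isOpen_setOf_det_fst_ne_zero.preimage
    (continuous_fst.comp (blockEquiv e e').continuous), hdet, hchart⟩

theorem mul_add_sub_lt_mul_add_sub {j k a b : ℕ} (hj : j < k) (ha : k ≤ a) (hb : k ≤ b) :
    j * (a + b - j) < k * (a + b - k) := by
  obtain ⟨a, rfl⟩ := Nat.exists_eq_add_of_le ha
  obtain ⟨b, rfl⟩ := Nat.exists_eq_add_of_le hb
  obtain ⟨i, rfl⟩ := Nat.exists_eq_add_of_lt hj
  rw [show j + i + 1 + a + (j + i + 1 + b) - j = j + 2 * i + 2 + a + b by omega,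
    show j + i + 1 + a + (j + i + 1 + b) - (j + i + 1) = j + i + 1 + a + b by omega]
  nlinarith

theorem isThinRel_setOf_rank_lt {k : ℕ} (hm : k ≤ Fintype.card m) (hn : k ≤ Fintype.card n) :
    IsThinRel {A : Matrix m n 𝕜 | A.rank < k}
      (k * (Fintype.card m + Fintype.card n - k) * finrank ℝ 𝕜) := by
  have hstratum (j : Fin k) : IsThinRel {A : Matrix m n 𝕜 | A.rank = j}
      (k * (Fintype.card m + Fintype.card n - k) * finrank ℝ 𝕜) :=
    (isSmoothSubmanifold_setOf_rank_eq _).isThinRel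
      (Nat.mul_lt_mul_of_pos_right (mul_add_sub_lt_mul_add_sub j.2 hm hn) finrank_pos)
  exact (IsThinRel.iUnion hstratum).mono fun A hA => Set.mem_iUnion.2 ⟨⟨A.rank, hA⟩, rfl⟩

omit [Fintype m] in
theorem isClosed_setOf_rank_le [Finite m] (k : ℕ) : IsClosed {A : Matrix m n 𝕜 | A.rank ≤ k} := by
  rw [← isOpen_compl_iff, isOpen_iff_mem_nhds]
  intro A hA
  obtain ⟨r, c, hdet⟩ := exists_submatrix_det_ne_zero (rfl : A.rank = A.rank)
  have hopen : IsOpen {B : Matrix m n 𝕜 | (B.submatrix r c).det ≠ 0} :=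
    isOpen_ne_fun (continuous_id.matrix_submatrix r c).matrix_det continuous_const
  filter_upwards [hopen.mem_nhds hdet] with B hB
  refine fun hBk => hA (le_trans (b := B.rank) ?_ hBk)
  calc A.rank = (B.submatrix r c).rank := by rw [rank_of_det_ne_zero hB, Fintype.card_fin]
    _ ≤ B.rank := rank_submatrix_le B r c

variable [DecidableEq n]

theorem setOf_rank_le_subset_closure {k : ℕ} (hm : k ≤ Fintype.card m)
    (hn : k ≤ Fintype.card n) : {A : Matrix m n 𝕜 | A.rank ≤ k} ⊆
      closure {A | A.rank ≤ k ∧ hankelDet k A ≠ 0} := by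
  intro A hA
  obtain ⟨B, C, rfl⟩ := rank_le_iff_exists_eq_mul.1 hA
  have hmul : IsPolynomialMap
      fun x : Matrix m (Fin k) 𝕜 × Matrix (Fin k) n 𝕜 => x.1 * x.2 :=
    .matrix_mul (.of_clm (.fst ℝ (Matrix m (Fin k) 𝕜) (Matrix (Fin k) n 𝕜)))
      (.of_clm (.snd ℝ (Matrix m (Fin k) 𝕜) (Matrix (Fin k) n 𝕜)))
  obtain ⟨B₀, C₀, h₀⟩ := exists_hankelDet_mul_ne_zero (𝕜 := 𝕜) hm hn
  have hdense := (hmul.hankelDet k).dense_setOf_ne_zero (x := (B₀, C₀)) h₀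
  exact map_mem_closure (f := fun x : Matrix m (Fin k) 𝕜 × Matrix (Fin k) n 𝕜 => x.1 * x.2)
    hmul.differentiable.continuous (hdense (B, C)) fun x hx =>
      ⟨rank_le_iff_exists_eq_mul.2 ⟨_, _, rfl⟩, hx⟩

section HankelNumerator

variable {k : ℕ} {μ ν : Type*} (e : Fin k ⊕ μ ≃ m) (e' : Fin k ⊕ ν ≃ n)

/-- The polynomial obtained from the Hankel determinant of the rank `k` completion of three blocks
by multiplying the completion by the determinant of its corner. -/
noncomputable def hankelNumerator (x : CornerBlocks (Fin k) μ ν 𝕜) : ℝ :=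
  hankelDet k ((blockEquiv e e').symm (x.1.det • x, x.2.2 * x.1.adjugate * x.2.1))

theorem hankelNumerator_ne_zero_iff {A : Matrix m n 𝕜}
    (hA : (blockEquiv e e' A).1.1.det ≠ 0) (hrank : A.rank = k) :
    hankelNumerator e e' (blockEquiv e e' A).1 ≠ 0 ↔ hankelDet k A ≠ 0 := by
  have hschur := (rank_eq_card_iff_eq_schurBlock e e' hA).1 (hrank.trans (Fintype.card_fin k).symm)
  set x := (blockEquiv e e' A).1
  have hscale : (x.1.det • x, x.2.2 * x.1.adjugate * x.2.1) =
      blockEquiv e e' (x.1.det • A) := by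
    refine Prod.ext rfl ?_
    rw [blockEquiv_smul, Prod.smul_snd, hschur, schurBlock_eq_inv_det_smul, smul_inv_smul₀ hA]
  rw [hankelNumerator, hscale, ContinuousLinearEquiv.symm_apply_apply,
    hankelDet_smul_ne_zero_iff hA]

theorem exists_hankelNumerator_ne_zero :
    ∃ x : CornerBlocks (Fin k) μ ν 𝕜, hankelNumerator e e' x ≠ 0 := by
  have hm : k ≤ Fintype.card m := by
    simpa using Fintype.card_le_of_injective _ (e.injective.comp Sum.inl_injective)
  have hn : k ≤ Fintype.card n := by
    simpa using Fintype.card_le_of_injective _ (e'.injective.comp Sum.inl_injective)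
  have hopen : IsOpen {A : Matrix m n 𝕜 | (blockEquiv e e' A).1.1.det ≠ 0} :=
    isOpen_setOf_det_fst_ne_zero.preimage (continuous_fst.comp (blockEquiv e e').continuous)
  set A₀ : Matrix m n 𝕜 := (blockEquiv e e').symm ((1, 0, 0), 0)
  have hA₀ : blockEquiv e e' A₀ = ((1, 0, 0), 0) := ContinuousLinearEquiv.apply_symm_apply _ _
  have hdet₀ : (blockEquiv e e' A₀).1.1.det ≠ 0 := by simp [hA₀]
  have hrank₀ : A₀.rank ≤ k := by
    simpa using ((rank_eq_card_iff_eq_schurBlock e e' hdet₀).2 (by simp [hA₀, schurBlock])).le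
  obtain ⟨A, hdet, hrank, hA⟩ :=
    mem_closure_iff.1 (setOf_rank_le_subset_closure hm hn hrank₀) _ hopen hdet₀
  refine ⟨_, (hankelNumerator_ne_zero_iff e e' hdet (hrank.antisymm ?_)).2 hA⟩
  simpa using card_le_rank_of_blockEquiv e e' hdet

variable [Fintype μ] [Fintype ν]

theorem isPolynomialMap_hankelNumerator :
    IsPolynomialMap (hankelNumerator (𝕜 := 𝕜) e e') := by
  have hid : IsPolynomialMap fun x : CornerBlocks (Fin k) μ ν 𝕜 => x := .of_clm (.id ℝ _)
  exact (((isPolynomialMap_det_fst.smul hid).prodMk isPolynomialMap_mul_adjugate_mul).clm_comp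
    (blockEquiv e e').symm.toContinuousLinearMap).hankelDet k

end HankelNumerator

theorem isThinRel_setOf_rank_eq_and_hankelDet_eq_zero (k : ℕ) :
    IsThinRel {A : Matrix m n 𝕜 | A.rank = k ∧ hankelDet k A = 0}
      (k * (Fintype.card m + Fintype.card n - k) * finrank ℝ 𝕜) := by
  have hchart (e : Fin k ⊕ Fin (Fintype.card m - k) ≃ m)
      (e' : Fin k ⊕ Fin (Fintype.card n - k) ≃ n) :
      IsThinRel {A : Matrix m n 𝕜 | (blockEquiv e e' A).1.1.det ≠ 0 ∧
        hankelNumerator e e' (blockEquiv e e' A).1 = 0 ∧ A.rank = k}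
        (k * (Fintype.card m + Fintype.card n - k) * finrank ℝ 𝕜) := by
    obtain ⟨x, hx⟩ := exists_hankelNumerator_ne_zero (𝕜 := 𝕜) e e'
    simpa only [finrank_cornerBlocks e e', Fintype.card_fin, Set.mem_ofPred_eq] using
      ((isPolynomialMap_hankelNumerator e e').isThinRel_setOf_eq_zero
        hx).setOf_blockEquiv_mem_and_rank_eq e e'
  refine (IsThinRel.iUnion fun e => IsThinRel.iUnion fun e' => hchart e e').mono ?_
  rintro A ⟨hrank, hA⟩
  obtain ⟨e, e', hdet⟩ := exists_equiv_submatrix_det_ne_zero hrank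
  exact Set.mem_iUnion₂.2 ⟨e, e', hdet,
    not_imp_not.1 (hankelNumerator_ne_zero_iff e e' hdet hrank).1 hA, hrank⟩

end RankStrata

section RankDistinct

variable {N k : ℕ}

theorem mul_add_sub_mul_finrank_complex (N k : ℕ) :
    k * (Fintype.card (Fin N) + Fintype.card (Fin N) - k) * Module.finrank ℝ ℂ =
      2 * (2 * N * k - k ^ 2) := by
  rw [Fintype.card_fin, Complex.finrank_real_complex, ← two_mul, Nat.mul_sub, mul_comm k (2 * N),
    ← sq, mul_comm]

theorem isSmoothSubmanifold_rankDistinct (hk : k ≤ N) :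
    IsSmoothSubmanifold (rankDistinct N k) (2 * (2 * N * k - k ^ 2)) := by
  have hid : IsPolynomialMap fun A : Matrix (Fin N) (Fin N) ℂ => A := .of_clm (.id ℝ _)
  have hopen : IsOpen {A : Matrix (Fin N) (Fin N) ℂ | hankelDet k A ≠ 0} :=
    isOpen_ne_fun (hid.hankelDet k).differentiable.continuous continuous_const
  have hinter : rankDistinct N k = {A | hankelDet k A ≠ 0} ∩ {A | A.rank = k} := by
    ext A
    exact ⟨fun h => ⟨((mem_rankDistinct_iff hk).1 h).2, rank_of_mem_rankDistinct h⟩,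
      fun h => (mem_rankDistinct_iff hk).2 ⟨h.2.le, h.1⟩⟩
  rw [hinter, ← mul_add_sub_mul_finrank_complex]
  exact (isSmoothSubmanifold_setOf_rank_eq k).isOpen_inter hopen

theorem rankAtMost_eq_closure_rankDistinct (hk : k ≤ N) :
    rankAtMost N k = closure (rankDistinct N k) := by
  have hcard : k ≤ Fintype.card (Fin N) := hk.trans_eq (Fintype.card_fin N).symm
  refine subset_antisymm ?_ (closure_minimal (fun A hA => hA.1) (isClosed_setOf_rank_le k))
  rw [show rankDistinct N k = {A | A.rank ≤ k ∧ hankelDet k A ≠ 0} from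
    Set.ext fun A => mem_rankDistinct_iff hk]
  exact setOf_rank_le_subset_closure hcard hcard

theorem isThinRel_rankAtMost_diff_rankDistinct (hk : k ≤ N) :
    IsThinRel (rankAtMost N k \ rankDistinct N k) (2 * (2 * N * k - k ^ 2)) := by
  have hcard : k ≤ Fintype.card (Fin N) := hk.trans_eq (Fintype.card_fin N).symm
  rw [← mul_add_sub_mul_finrank_complex]
  refine ((isThinRel_setOf_rank_lt hcard hcard).union
    (isThinRel_setOf_rank_eq_and_hankelDet_eq_zero k)).mono ?_
  rintro A ⟨hA, hAd⟩
  rcases lt_or_eq_of_le (show A.rank ≤ k from hA) with hlt | hrank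
  · exact .inl hlt
  · refine .inr ⟨hrank, ?_⟩
    by_contra hne
    exact hAd ((mem_rankDistinct_iff hk).2 ⟨hA, hne⟩)

end RankDistinct

theorem proposition3 (N k : ℕ) (hk : k ≤ N) :
    IsSmoothSubmanifold (rankDistinct N k) (2 * (2 * N * k - k ^ 2)) ∧
    rankAtMost N k = closure (rankDistinct N k) ∧
    IsThinRel (rankAtMost N k \ rankDistinct N k) (2 * (2 * N * k - k ^ 2)) :=
  ⟨isSmoothSubmanifold_rankDistinct hk, rankAtMost_eq_closure_rankDistinct hk,
    isThinRel_rankAtMost_diff_rankDistinct hk⟩
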